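/- Let $N,d\ge 1$, let $\Omega\subseteq\mathbb R^N$ be a bounded open set, and let $p_n:\Omega\to(1,+\infty)$ $(n\in\mathbb N)$ be Lebesgue measurable functions such that, with $p_n^-:=\operatorname{ess\,inf}_\Omega p_n$ and $p_n^+:=\operatorname{ess\,sup}_\Omega p_n$, one has $p_n^-\to+\infty$ as $n\to\infty$, and there is $\beta>1$ with $p_n^+\le\beta\,p_n^-$ for all $n$. Let $f:\Omega\times\mathbb R^d\times\mathbb R^{Nd}\to\mathbb R$ be a normal integrand, i.e. $f$ is measurable with respect to the product of the Lebesgue $\sigma$-algebra of $\Omega$ and the Borel $\sigma$-algebras of $\mathbb R^d$ and $\mathbb R^{Nd}$, and $f(x,\cdot,\cdot)$ is lower semicontinuous for a.e. $x\in\Omega$. Assume: (H1) for a.e. $x\in\Omega$, $f(x,u,\cdot)$ is level convex for every $u\in\mathbb R^d$, i.e. the set $\{\xi\in\mathbb R^{Nd}: f(x,u,\xi)\le t\}$ is convex for every $t\in\mathbb R$; (H2) there are $\alpha,\gamma>0$ such that $f(x,u,\xi)\ge\alpha|\xi|^\gamma$ for a.e. $x\in\Omega$ and every $(u,\xi)\in\mathbb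 R^d\times\mathbb R^{Nd}$. Let $X$ be either $L^\infty(\Omega,\mathbb R^d)$ or the space $C(\Omega,\mathbb R^d)$ of bounded continuous functions $\Omega\to\mathbb R^d$, endowed with the norm $\|\cdot\|_\infty$. Let $W^{1,p_n(\cdot)}(\Omega,\mathbb R^d)$ be the set of functions $u$ with a weak gradient $Du$ in $\Omega$ such that $\int_\Omega|u|^{p_n(x)}dx<\infty$ and $\int_\Omega|Du|^{p_n(x)}dx<\infty$. Define $\mathcal F_n,\mathcal F:X\to[0,+\infty]$ by $$\mathcal F_n(u):=\begin{cases}\displaystyle\int_\Omega\frac1{p_n(x)}\,f^{p_n(x)}(x,u(x),Du(x))\,dx&\text{if }u\in W^{1,p_n(\cdot)}(\Omega,\mathbb R^d),\\ +\infty&\text{otherwise,}\end{cases}$$ $$\mathcal F(u):=\begin{cases}0&\text{if }u\in W^{1,\infty}(\Omega,\mathbb R^d)\text{ and }\|f(\cdot,u(\cdot),Du(\cdot))\|_\infty\le1,\\ +\infty&\text{otherwise.}\end{cases}$$ Then: (i) for every $u\in X$ and every sequence $(u_n)\subset X$ with $u_n\to u$ in $X$, $\ \mathcal F(u)\le\liminf_{n\to\infty}\mathcal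 F_n(u_n)$; (ii) for every $u\in X$ there is a sequence $(u_n)\subset X$ with $u_n\to u$ in $X$ and $\limsup_{n\to\infty}\mathcal F_n(u_n)\le\mathcal F(u)$. In particular, $(\mathcal F_n)$ $\Gamma$-converges to $\mathcal F$ as $n\to+\infty$ with respect to the norm topology of $X$. -/

import Mathlib

open MeasureTheory Filter Topology Set
open scoped ENNReal BoundedContinuousFunction

noncomputable section

/-- `RVec k` is `ℝᵏ` with its Euclidean norm. -/
abbrev RVec (k : ℕ) : Type := EuclideanSpace ℝ (Fin k)

/-- `RMat d N` is `ℝ^{Nd}`, the space of gradients, with its Euclidean norm; the entry `(j, i)` of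
a gradient is the partial derivative of the `j`-th component in the `i`-th direction. -/
abbrev RMat (d N : ℕ) : Type := EuclideanSpace ℝ (Fin d × Fin N)

/-- `G` is a weak (distributional) gradient of `u` in the open set `Ω`: both are locally integrable
in `Ω`, and the integration by parts formula holds against all test functions in `C_c^∞(Ω)`. -/
def HasWeakGradient {N d : ℕ} (Ω : Set (RVec N)) (u : RVec N → RVec d)
    (G : RVec N → RMat d N) : Prop :=
  LocallyIntegrableOn u Ω volume ∧ LocallyIntegrableOn G Ω volume ∧
    ∀ φ : RVec N → ℝ, ContDiff ℝ (⊤ : ℕ∞) φ → HasCompactSupport φ → tsupport φ ⊆ Ω →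
      ∀ (j : Fin d) (i : Fin N),
        ∫ x in Ω, u x j * fderiv ℝ φ x (EuclideanSpace.single i 1) = - ∫ x in Ω, G x (j, i) * φ x

open Classical in
/-- The weak gradient `Du` of `u` in `Ω`, a function determined up to a null subset of `Ω` when a
weak gradient exists (see `HasWeakGradient.ae_eq`); otherwise it is set to `0`. -/
def weakGrad {N d : ℕ} (Ω : Set (RVec N)) (u : RVec N → RVec d) : RVec N → RMat d N :=
  if h : ∃ G, HasWeakGradient Ω u G then h.choose else 0

theorem HasWeakGradient.weakGrad {N d : ℕ} {Ω : Set (RVec N)} {u : RVec N → RVec d}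
    {G : RVec N → RMat d N} (h : HasWeakGradient Ω u G) :
    HasWeakGradient Ω u (weakGrad Ω u) := by
  have hex : ∃ G, HasWeakGradient Ω u G := ⟨G, h⟩
  unfold _root_.weakGrad
  rw [dif_pos hex]
  exact hex.choose_spec

theorem HasWeakGradient.ae_eq {N d : ℕ} {Ω : Set (RVec N)} (hΩ : IsOpen Ω)
    {u : RVec N → RVec d} {G G' : RVec N → RMat d N}
    (h : HasWeakGradient Ω u G) (h' : HasWeakGradient Ω u G') :
    ∀ᵐ x ∂(volume.restrict Ω), G x = G' x := by
  have key : ∀ q : Fin d × Fin N, ∀ᵐ x ∂(volume.restrict Ω), G x q = G' x q := by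
    rintro ⟨j, i⟩
    have c : ∀ K : RVec N → RMat d N, LocallyIntegrableOn K Ω volume →
        LocallyIntegrableOn (fun x => K x (j, i)) Ω volume := by
      intro K hK x hx
      obtain ⟨s, hs, hi⟩ := hK x hx
      exact ⟨s, hs, (EuclideanSpace.proj (j, i) : RMat d N →L[ℝ] ℝ).integrable_comp hi⟩
    have cG := c G h.2.1
    have cG' := c G' h'.2.1
    have hz := hΩ.ae_eq_zero_of_integral_contDiff_smul_eq_zero (μ := volume)
      (f := fun x => G x (j, i) - G' x (j, i)) (cG.sub cG') (by
        intro φ hφ hc hs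
        have sub : ∀ K : RVec N → ℝ, (∫ x, φ x • K x) = ∫ x in Ω, K x * φ x := by
          intro K
          rw [setIntegral_eq_integral_of_forall_compl_eq_zero]
          · simp [mul_comm]
          · intro x hx
            have : φ x = 0 := image_eq_zero_of_notMem_tsupport fun hh => hx (hs hh)
            simp [this]
        have int : ∀ K : RVec N → ℝ, LocallyIntegrableOn K Ω volume →
            IntegrableOn (fun x => K x * φ x) Ω volume := by
          intro K hK
          have h1 : IntegrableOn K (tsupport φ) volume :=
            hK.integrableOn_compact_subset hs hc
          have h2 : IntegrableOn (fun x => K x * φ x) (tsupport φ) volume :=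
            h1.mul_continuousOn hφ.continuous.continuousOn hc
          have h3 : Integrable (fun x => K x * φ x) volume :=
            (integrableOn_iff_integrable_of_support_subset (by
              intro x hx
              by_contra hh
              exact hx (by simp [image_eq_zero_of_notMem_tsupport hh]))).1 h2
          exact h3.integrableOn
        rw [sub]
        simp only [sub_mul]
        rw [integral_sub (int _ cG) (int _ cG')]
        have e := h.2.2 φ hφ hc hs j i
        have e' := h'.2.2 φ hφ hc hs j i
        linarith)
    rw [ae_restrict_iff' hΩ.measurableSet]
    filter_upwards [hz] with x hx hxΩ
    exact sub_eq_zero.1 (hx hxΩ)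
  filter_upwards [ae_all_iff.2 key] with x hx
  ext q
  exact hx q

/-- `v ∈ L^{p(·)}(Ω; V)` for a (bounded) variable exponent `p`: `v` is measurable in `Ω` and
`∫_Ω |v|^{p(x)} dx < ∞`. -/
def MemLpVar {N : ℕ} {V : Type*} [NormedAddCommGroup V] (Ω : Set (RVec N)) (p : RVec N → ℝ)
    (v : RVec N → V) : Prop :=
  AEStronglyMeasurable v (volume.restrict Ω) ∧ ∫⁻ x in Ω, ‖v x‖ₑ ^ p x < ∞

/-- `u ∈ W^{1,p(·)}(Ω; ℝᵈ)`. -/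
def MemW1Var {N d : ℕ} (Ω : Set (RVec N)) (p : RVec N → ℝ) (u : RVec N → RVec d) : Prop :=
  MemLpVar Ω p u ∧ ∃ G : RVec N → RMat d N, HasWeakGradient Ω u G ∧ MemLpVar Ω p G

/-- `u ∈ W^{1,∞}(Ω; ℝᵈ)`. -/
def MemW1Infty {N d : ℕ} (Ω : Set (RVec N)) (u : RVec N → RVec d) : Prop :=
  MemLp u ∞ (volume.restrict Ω) ∧
    ∃ G : RVec N → RMat d N, HasWeakGradient Ω u G ∧ MemLp G ∞ (volume.restrict Ω)

/-- `p⁻ = ess inf_Ω p`, for a non-negative exponent `p`. -/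
def expInf {N : ℕ} (Ω : Set (RVec N)) (p : RVec N → ℝ) : ℝ≥0∞ :=
  essInf (fun x => ENNReal.ofReal (p x)) (volume.restrict Ω)

/-- `p⁺ = ess sup_Ω p`, for a non-negative exponent `p`. -/
def expSup {N : ℕ} (Ω : Set (RVec N)) (p : RVec N → ℝ) : ℝ≥0∞ :=
  essSup (fun x => ENNReal.ofReal (p x)) (volume.restrict Ω)

/-- `f : Ω × ℝᵈ × ℝ^{Nd} → ℝ` is a normal integrand: it is measurable for the product of the
Lebesgue σ-algebra of `Ω` with the Borel σ-algebras, and `f(x,·,·)` is lower semicontinuous for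
a.e. `x ∈ Ω`. The values of `f` at points `x ∉ Ω` play no role. -/
def IsNormalIntegrand {N d : ℕ} (Ω : Set (RVec N)) (f : RVec N → RVec d → RMat d N → ℝ) : Prop :=
  Measurable (fun z : NullMeasurableSpace (RVec N) volume × RVec d × RMat d N =>
      Ω.indicator (fun x : RVec N => f x z.2.1 z.2.2) z.1) ∧
    ∀ᵐ x ∂(volume.restrict Ω), LowerSemicontinuous (fun w : RVec d × RMat d N => f x w.1 w.2)

open Classical in
/-- The functional equal to `∫_Ω (1/p(x)) f^{p(x)}(x,u,Du) dx` if `u ∈ W^{1,p(·)}(Ω; ℝᵈ)` and to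
`+∞` otherwise (for an integrand `f` that is non-negative for a.e. `x ∈ Ω`). -/
def powerFunctional {N d : ℕ} (Ω : Set (RVec N)) (f : RVec N → RVec d → RMat d N → ℝ)
    (p : RVec N → ℝ) (u : RVec N → RVec d) : ℝ≥0∞ :=
  if MemW1Var Ω p u then
    ∫⁻ x in Ω, ENNReal.ofReal (1 / p x * f x (u x) (weakGrad Ω u x) ^ p x)
  else ∞

open Classical in
/-- The functional equal to `0` if `u ∈ W^{1,∞}(Ω; ℝᵈ)` and `‖f(·,u,Du)‖_∞ ≤ 1`, and to `+∞`
otherwise. -/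
def constraintFunctional {N d : ℕ} (Ω : Set (RVec N)) (f : RVec N → RVec d → RMat d N → ℝ)
    (u : RVec N → RVec d) : ℝ≥0∞ :=
  if MemW1Infty Ω u ∧
      eLpNorm (fun x => f x (u x) (weakGrad Ω u x)) ∞ (volume.restrict Ω) ≤ 1 then 0
  else ∞

/-- A function on `Ω`, extended by `0` to the whole space. -/
def extendZero {N d : ℕ} {Ω : Set (RVec N)} (u : Ω → RVec d) : RVec N → RVec d :=
  Function.extend Subtype.val u 0

/-- The `Γ`-lower limit of a sequence of functionals on a topological space. -/
def gammaLiminf {X : Type*} [TopologicalSpace X] (Φ : ℕ → X → ℝ≥0∞) (x : X) : ℝ≥0∞ :=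
  ⨆ U ∈ 𝓝 x, liminf (fun n => ⨅ y ∈ U, Φ n y) atTop

/-- The `Γ`-upper limit of a sequence of functionals on a topological space. -/
def gammaLimsup {X : Type*} [TopologicalSpace X] (Φ : ℕ → X → ℝ≥0∞) (x : X) : ℝ≥0∞ :=
  ⨆ U ∈ 𝓝 x, limsup (fun n => ⨅ y ∈ U, Φ n y) atTop

/-- `Φ n` `Γ`-converges to `Ψ` with respect to the topology of `X`. -/
def GammaConverges {X : Type*} [TopologicalSpace X] (Φ : ℕ → X → ℝ≥0∞) (Ψ : X → ℝ≥0∞) : Prop :=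
  ∀ x, gammaLiminf Φ x = Ψ x ∧ gammaLimsup Φ x = Ψ x

/-- The `Γ`-liminf inequality along every convergent sequence. -/
def LiminfInequality {X : Type*} [TopologicalSpace X] (Φ : ℕ → X → ℝ≥0∞) (Ψ : X → ℝ≥0∞) : Prop :=
  ∀ (u : X) (v : ℕ → X), Tendsto v atTop (𝓝 u) → Ψ u ≤ liminf (fun n => Φ n (v n)) atTop

/-- The `Γ`-limsup inequality: every point has a recovery sequence. -/
def LimsupInequality {X : Type*} [TopologicalSpace X] (Φ : ℕ → X → ℝ≥0∞) (Ψ : X → ℝ≥0∞) : Prop :=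
  ∀ u : X, ∃ v : ℕ → X, Tendsto v atTop (𝓝 u) ∧ limsup (fun n => Φ n (v n)) atTop ≤ Ψ u

end

/-! Upper bound: the constant sequence recovers. If `0 ≤ f ≤ 1` along `(u, Du)`, the energy density
is at most `1 / p n`, which tends to `0` uniformly on a set of finite measure; the ratio bound makes
each `p n` essentially bounded, so `W^{1,∞}` lies in the variable exponent space.

Lower bound: suppose the energies stay below `C` along a subsequence and write `h` for `f` along it.
On `{h > t}` with `t > 1`, a large exponent makes `h ^ p / p` dominate any fixed power of `h`, with
an arbitrarily small factor (`exists_rpow_le_mul_rpow`). The power `2 / γ` and coercivity bound the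
gradients in `L²`; the small factors and Borel-Cantelli give, for a.e. `x`, eventually `h k x ≤ t k`
with `t k → 1`.

Instead of a weak limit, a point `w` common to the closed convex hulls of all tails of the gradients
in `L²` is used. Testing against smooth functions is linear and continuous, so `w` is the weak
gradient of `u`. Almost everywhere `w x` also lies in the hulls of the tails of the pointwise
values, and there level convexity, joint lower semicontinuity and coercivity give `f x (u x) (w x) ≤
1`. -/

/-! ### Closed convex hulls of tails -/

theorem closedConvexHull_mono' {E : Type*} [AddCommGroup E] [Module ℝ E] [TopologicalSpace E]
    {s t : Set E} (h : s ⊆ t) : closedConvexHull ℝ s ⊆ closedConvexHull ℝ t :=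
  (closedConvexHull ℝ).monotone h

/-- A bounded sequence in a Hilbert space has a point common to the closed convex hulls of all its
tails. -/
theorem exists_forall_mem_closedConvexHull_tail {H : Type*} [NormedAddCommGroup H]
    [InnerProductSpace ℝ H] [CompleteSpace H] (v : ℕ → H) (R : ℝ) (hv : ∀ n, ‖v n‖ ≤ R) :
    ∃ w, ∀ k, w ∈ closedConvexHull ℝ (v '' Ici k) := by
  -- `y k` is the point of least norm in the `k`-th hull. The hulls decrease, so the norms increase
  -- and stay below `R`; the variational inequality then makes `y` Cauchy, and its limit lies in
  -- every hull.
  have hmin : ∀ k, ∃ y ∈ closedConvexHull ℝ (v '' Ici k),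
      ∀ z ∈ closedConvexHull ℝ (v '' Ici k), inner ℝ (0 - y) (z - y) ≤ 0 := by
    intro k
    obtain ⟨y, hy, hy'⟩ := exists_norm_eq_iInf_of_complete_convex
      (K := closedConvexHull ℝ (v '' Ici k))
      ⟨v k, subset_closedConvexHull ⟨k, mem_Ici.2 le_rfl, rfl⟩⟩
      isClosed_closedConvexHull.isComplete convex_closedConvexHull 0
    exact ⟨y, hy, (norm_eq_iInf_iff_real_inner_le_zero convex_closedConvexHull hy).1 hy'⟩
  choose y hy hyin using hmin
  have hmem : ∀ {j k}, k ≤ j → y j ∈ closedConvexHull ℝ (v '' Ici k) := fun {j k} hkj =>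
    closedConvexHull_mono' (image_mono (Ici_subset_Ici.2 hkj)) (hy j)
  have hsq : ∀ {j k}, k ≤ j → ‖y j - y k‖ ^ 2 ≤ ‖y j‖ ^ 2 - ‖y k‖ ^ 2 := by
    intro j k hkj
    have h1 := hyin k _ (hmem hkj)
    have h2 := norm_sub_sq_real (y j) (y k)
    simp only [zero_sub, inner_neg_left, inner_sub_right, real_inner_self_eq_norm_sq] at h1
    rw [real_inner_comm] at h1
    linarith
  have hR : ∀ k, ‖y k‖ ≤ R := by
    intro k
    have : closedConvexHull ℝ (v '' Ici k) ⊆ Metric.closedBall 0 R := by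
      refine closedConvexHull_min ?_ (convex_closedBall 0 R) Metric.isClosed_closedBall
      rintro _ ⟨m, -, rfl⟩
      simpa using hv m
    simpa using this (hy k)
  have hmono : Monotone fun k => ‖y k‖ ^ 2 := fun k j hkj => by
    have := hsq hkj
    have := sq_nonneg ‖y j - y k‖
    dsimp only
    linarith
  have hbdd : BddAbove (range fun k => ‖y k‖ ^ 2) :=
    ⟨R ^ 2, by rintro _ ⟨k, rfl⟩; exact pow_le_pow_left₀ (norm_nonneg _) (hR k) 2⟩
  have hc := (tendsto_atTop_ciSup hmono hbdd).cauchySeq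
  have hyc : CauchySeq y := by
    rw [Metric.cauchySeq_iff'] at hc ⊢
    intro ε hε
    obtain ⟨M, hM⟩ := hc (ε ^ 2) (by positivity)
    refine ⟨M, fun n hn => ?_⟩
    have h1 := (le_abs_self _).trans_lt (hM n hn)
    have h2 := hsq hn
    rw [dist_eq_norm]
    exact lt_of_pow_lt_pow_left₀ 2 hε.le (h2.trans_lt h1)
  obtain ⟨w, hw⟩ := cauchySeq_tendsto_of_complete hyc
  refine ⟨w, fun k => isClosed_closedConvexHull.mem_of_tendsto hw ?_⟩
  filter_upwards [eventually_ge_atTop k] with j hj using hmem hj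

/-- If a continuous linear functional converges along a sequence, then it takes the limit value at
each point common to the closed convex hulls of the tails. -/
theorem apply_eq_of_forall_mem_closedConvexHull_tail {H : Type*} [NormedAddCommGroup H]
    [NormedSpace ℝ H] {v : ℕ → H} {w : H} (hw : ∀ k, w ∈ closedConvexHull ℝ (v '' Ici k))
    (ℓ : H →L[ℝ] ℝ) {c : ℝ} (hc : Tendsto (fun n => ℓ (v n)) atTop (𝓝 c)) : ℓ w = c := by
  refine eq_of_forall_dist_le fun ε hε => ?_
  obtain ⟨k, hk⟩ := (Metric.tendsto_atTop.1 hc) ε hε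
  have : closedConvexHull ℝ (v '' Ici k) ⊆ ℓ ⁻¹' Metric.closedBall c ε := by
    refine closedConvexHull_min ?_ ((convex_closedBall c ε).linear_preimage ℓ.toLinearMap)
      (Metric.isClosed_closedBall.preimage ℓ.continuous)
    rintro _ ⟨m, hm, rfl⟩
    exact (hk m hm).le
  exact this (hw k)

/-- Pointwise almost everywhere membership in closed convex sets defines a closed convex set of
`L^p` functions. -/
theorem convex_setOf_ae_mem {α E : Type*} [MeasurableSpace α] {μ : Measure α}
    [NormedAddCommGroup E] [NormedSpace ℝ E] {q : ℝ≥0∞} {A : α → Set E}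
    (hA : ∀ x, Convex ℝ (A x)) : Convex ℝ {v : Lp E q μ | ∀ᵐ x ∂μ, v x ∈ A x} := by
  intro v hv w hw a b ha hb hab
  filter_upwards [hv, hw, Lp.coeFn_add (a • v) (b • w), Lp.coeFn_smul a v, Lp.coeFn_smul b w]
    with x h1 h2 h3 h4 h5
  rw [h3, Pi.add_apply, h4, h5]
  exact hA x h1 h2 ha hb hab

/-- Convergence in `L^q` gives a.e. convergence along a subsequence, and each fibre is closed. -/
theorem isClosed_setOf_ae_mem {α E : Type*} [MeasurableSpace α] {μ : Measure α}
    [NormedAddCommGroup E] {q : ℝ≥0∞} [Fact (1 ≤ q)] {A : α → Set E}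
    (hA : ∀ x, IsClosed (A x)) : IsClosed {v : Lp E q μ | ∀ᵐ x ∂μ, v x ∈ A x} := by
  refine IsSeqClosed.isClosed fun v w hv hw => ?_
  obtain ⟨ns, -, hns⟩ := (tendstoInMeasure_of_tendsto_Lp hw).exists_seq_tendsto_ae
  filter_upwards [hns, ae_all_iff.2 hv] with x h1 h2
  exact (hA x).mem_of_tendsto h1 (Eventually.of_forall fun i => h2 _)

/-- The functions lying a.e. in the pointwise hulls form a closed convex set containing the tail,
hence its hull. -/
theorem ae_mem_closedConvexHull_tail {α E : Type*} [MeasurableSpace α] {μ : Measure α}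
    [NormedAddCommGroup E] [NormedSpace ℝ E] {q : ℝ≥0∞} [Fact (1 ≤ q)] {v : ℕ → Lp E q μ}
    {w : Lp E q μ} (hw : ∀ k, w ∈ closedConvexHull ℝ (v '' Ici k)) :
    ∀ᵐ x ∂μ, ∀ k, w x ∈ closedConvexHull ℝ ((fun n => v n x) '' Ici k) := by
  rw [ae_all_iff]
  intro k
  have : closedConvexHull ℝ (v '' Ici k) ⊆
      {z : Lp E q μ | ∀ᵐ x ∂μ, z x ∈ closedConvexHull ℝ ((fun n => v n x) '' Ici k)} := by
    refine closedConvexHull_min ?_ (convex_setOf_ae_mem fun x => convex_closedConvexHull)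
      (isClosed_setOf_ae_mem fun x => isClosed_closedConvexHull)
    rintro _ ⟨m, hm, rfl⟩
    exact ae_of_all μ fun x => subset_closedConvexHull ⟨m, hm, rfl⟩
  exact this (hw k)

/-- The pointwise lower semicontinuity statement for level convex coercive integrands. -/
theorem le_of_forall_mem_closedConvexHull_tail {U E : Type*} [TopologicalSpace U]
    [NormedAddCommGroup E] [NormedSpace ℝ E] [ProperSpace E] {g : U → E → ℝ}
    (hg : LowerSemicontinuous fun z : U × E => g z.1 z.2) {u : U}
    (hconv : QuasiconvexOn ℝ univ (g u)) {α γ : ℝ} (hα : 0 < α) (hγ : 0 < γ)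
    (hcoer : ∀ u ξ, α * ‖ξ‖ ^ γ ≤ g u ξ) {us : ℕ → U} (hu : Tendsto us atTop (𝓝 u))
    {ξ : ℕ → E} {t : ℕ → ℝ} {c : ℝ} (ht : Tendsto t atTop (𝓝 c))
    (hle : ∀ᶠ k in atTop, g (us k) (ξ k) ≤ t k) {ζ : E}
    (hζ : ∀ k, ζ ∈ closedConvexHull ℝ (ξ '' Ici k)) : g u ζ ≤ c := by
  set S : Set E := {η | g u η ≤ c}
  have hScl : IsClosed S :=
    (hg.isClosed_preimage c).preimage (Continuous.prodMk_right u)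
  have hScv : Convex ℝ S := by simpa [S] using hconv c
  have hbd : ∀ᶠ k in atTop, ξ k ∈ Metric.closedBall (0 : E) (((c + 1) / α) ^ γ⁻¹) := by
    filter_upwards [hle, ht.eventually_lt_const (lt_add_one c)] with k h1 h2
    have h3 := hcoer (us k) (ξ k)
    have h4 : ‖ξ k‖ ^ γ ≤ (c + 1) / α := by
      rw [le_div_iff₀ hα]
      linarith
    rw [mem_closedBall_zero_iff]
    exact (Real.le_rpow_inv_iff_of_pos (norm_nonneg _)
      ((Real.rpow_nonneg (norm_nonneg _) _).trans h4) hγ).2 h4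
  -- Otherwise a bounded subsequence stays outside the `δ`-neighbourhood of `S`; by joint lower
  -- semicontinuity a cluster point of it lies in `S`, which is absurd.
  have hthick : ∀ δ > 0, ∀ᶠ k in atTop, ξ k ∈ Metric.cthickening δ S := by
    intro δ hδ
    by_contra hcon
    rw [not_eventually] at hcon
    obtain ⟨ψ, hψ, hψ'⟩ := extraction_of_frequently_atTop (hcon.and_eventually hbd)
    obtain ⟨η, -, θ, hθ, hlim⟩ := (isCompact_closedBall (0 : E) _).tendsto_subseq
      (fun n => (hψ' n).2)
    have hsub : Tendsto (ψ ∘ θ) atTop atTop := hψ.tendsto_atTop.comp hθ.tendsto_atTop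
    have hηS : η ∈ S := by
      by_contra hy
      obtain ⟨z, hz, hz'⟩ := exists_between (not_le.1 (show ¬ g u η ≤ c from hy))
      have hev : ∀ᶠ n in atTop, z < g (us (ψ (θ n))) (ξ (ψ (θ n))) :=
        ((hu.comp hsub).prodMk_nhds hlim).eventually (hg (u, η) z hz')
      have hzc : z ≤ c := by
        refine ge_of_tendsto (ht.comp hsub) ?_
        filter_upwards [hev, hsub.eventually hle] with n h1 h2 using h1.le.trans h2
      exact absurd hz (not_lt.2 hzc)
    have hout : ∀ n, δ ≤ dist (ξ (ψ (θ n))) η := by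
      intro n
      by_contra! hlt
      exact (hψ' (θ n)).1 (Metric.mem_cthickening_of_dist_le _ η δ S hηS hlt.le)
    have h0 : Tendsto (fun n => dist (ξ (ψ (θ n))) η) atTop (𝓝 0) :=
      tendsto_iff_dist_tendsto_zero.1 hlim
    exact absurd (ge_of_tendsto' h0 hout) (not_le.2 hδ)
  have hmem : ζ ∈ ⋂ (δ : ℝ) (_ : 0 < δ), Metric.cthickening δ S := by
    refine mem_iInter₂.2 fun δ hδ => ?_
    obtain ⟨k, hk⟩ := eventually_atTop.1 (hthick δ hδ)
    refine closedConvexHull_min ?_ (hScv.cthickening δ) Metric.isClosed_cthickening (hζ k)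
    rintro _ ⟨m, hm, rfl⟩
    exact hk m hm
  rw [← Metric.closure_eq_iInter_cthickening, hScl.closure_eq] at hmem
  exact hmem

/-! ### Domination of powers for large exponents -/

/-- For large exponents `p`, the function `y ^ p / p` dominates `y ^ r` uniformly on `(t, ∞)`. -/
theorem exists_rpow_le_mul_rpow (r : ℝ) {t ε : ℝ} (ht : 1 < t) (hε : 0 < ε) :
    ∃ Q : ℝ, ∀ p, Q ≤ p → ∀ y, t < y → y ^ r ≤ ε * (1 / p * y ^ p) := by
  have hlog := Real.log_pos ht
  have h1 : Tendsto (fun p : ℝ => t ^ r * (p ^ (1 : ℝ) * Real.exp (-Real.log t * p))) atTop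
      (𝓝 0) := by
    simpa using (tendsto_rpow_mul_exp_neg_mul_atTop_nhds_zero 1 _ hlog).const_mul (t ^ r)
  obtain ⟨Q, hQ⟩ := eventually_atTop.1 (h1.eventually_lt_const hε)
  refine ⟨max Q (max r 1), fun p hp y hy => ?_⟩
  have hp1 : 1 ≤ p := (le_max_right _ _).trans ((le_max_right _ _).trans hp)
  have hpr : r ≤ p := (le_max_left _ _).trans ((le_max_right _ _).trans hp)
  have hp0 : 0 < p := by linarith
  have ht0 : 0 < t := by linarith
  have hy0 : 0 < y := by linarith
  -- Divided by `y ^ r`, the claim reads `p ≤ ε * y ^ (p - r)`. As `p ≥ r`, the case `y = t`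
  -- suffices, and it holds by exponential growth.
  have h2 : p ≤ ε * t ^ (p - r) := by
    have := (hQ p ((le_max_left _ _).trans hp)).le
    rw [Real.rpow_one, show -Real.log t * p = Real.log t * (-p) by ring,
      ← Real.rpow_def_of_pos ht0, Real.rpow_neg ht0.le] at this
    rw [Real.rpow_sub ht0]
    have hA := Real.rpow_pos_of_pos ht0 r
    have hB := Real.rpow_pos_of_pos ht0 p
    rw [mul_div_assoc', le_div_iff₀ hA]
    have h3 : t ^ r * (p * (t ^ p)⁻¹) * t ^ p ≤ ε * t ^ p :=
      mul_le_mul_of_nonneg_right this hB.le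
    have h4 : t ^ r * (p * (t ^ p)⁻¹) * t ^ p = p * t ^ r := by
      field_simp
    linarith
  have h3 : t ^ (p - r) ≤ y ^ (p - r) :=
    Real.rpow_le_rpow ht0.le hy.le (by linarith)
  have h4 : p ≤ ε * y ^ (p - r) := h2.trans (mul_le_mul_of_nonneg_left h3 hε.le)
  have h5 : y ^ p = y ^ r * y ^ (p - r) := by
    rw [← Real.rpow_add hy0]
    ring_nf
  have hA := Real.rpow_pos_of_pos hy0 r
  calc y ^ r = y ^ r * (1 / p * p) := by field_simp
    _ ≤ y ^ r * (1 / p * (ε * y ^ (p - r))) := by gcongr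
    _ = ε * (1 / p * y ^ p) := by rw [h5]; ring

/-! ### From sequential inequalities to Γ-convergence -/

theorem gammaLimsup_le_of_tendsto {X : Type*} [TopologicalSpace X] {Φ : ℕ → X → ℝ≥0∞}
    {v : ℕ → X} {x : X} (hv : Tendsto v atTop (𝓝 x)) :
    gammaLimsup Φ x ≤ limsup (fun n => Φ n (v n)) atTop := by
  refine iSup₂_le fun U hU => limsup_le_limsup ?_
  filter_upwards [hv hU] with n hn using iInf₂_le (v n) hn

theorem gammaLiminf_le_gammaLimsup {X : Type*} [TopologicalSpace X] (Φ : ℕ → X → ℝ≥0∞) (x : X) :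
    gammaLiminf Φ x ≤ gammaLimsup Φ x :=
  iSup₂_mono fun _ _ => liminf_le_limsup

/-- If the inequality failed, near-minimizers in a shrinking countable basis at `x`, chosen at
increasing indices, would form a convergent sequence violating the sequential bound. -/
theorem LiminfInequality.le_gammaLiminf {X : Type*} [TopologicalSpace X]
    [FirstCountableTopology X] {Φ : ℕ → X → ℝ≥0∞} {Ψ : X → ℝ≥0∞} (h : LiminfInequality Φ Ψ)
    (x : X) : Ψ x ≤ gammaLiminf Φ x := by
  by_contra! hlt
  obtain ⟨c, hc, hcΨ⟩ := exists_between hlt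
  obtain ⟨B, hB⟩ := (𝓝 x).exists_antitone_basis
  have hfreq : ∀ k, ∃ᶠ n in atTop, ∃ y ∈ B k, Φ n y < c := by
    intro k
    have h1 : liminf (fun n => ⨅ y ∈ B k, Φ n y) atTop < c :=
      (le_iSup₂ (f := fun U (_ : U ∈ 𝓝 x) => liminf (fun n => ⨅ y ∈ U, Φ n y) atTop)
        (B k) (hB.1.mem_of_mem trivial)).trans_lt hc
    refine (frequently_lt_of_liminf_lt (by isBoundedDefault) h1).mono fun n hn => ?_
    simpa [iInf_lt_iff] using hn
  obtain ⟨φ, hφ, hφ'⟩ := extraction_forall_of_frequently hfreq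
  choose y hyB hyc using hφ'
  -- Indices outside the range of `φ` receive the value `x`, which keeps the full sequence
  -- convergent.
  set v : ℕ → X := Function.extend φ y fun _ => x
  have hv : Tendsto v atTop (𝓝 x) := by
    rw [hB.1.tendsto_right_iff]
    intro k _
    filter_upwards [eventually_ge_atTop (φ k)] with n hn
    by_cases hex : ∃ m, φ m = n
    · obtain ⟨m, rfl⟩ := hex
      simp only [v, hφ.injective.extend_apply]
      exact hB.2 (hφ.le_iff_le.1 hn) (hyB m)
    · simp only [v, Function.extend_apply' _ _ _ hex]
      exact mem_of_mem_nhds (hB.1.mem_of_mem trivial)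
  have h2 : liminf (fun n => Φ n (v n)) atTop ≤ c := by
    refine liminf_le_of_frequently_le' ?_
    rw [frequently_atTop]
    intro M
    refine ⟨φ M, hφ.id_le M, ?_⟩
    simp only [v, hφ.injective.extend_apply]
    exact (hyc M).le
  exact absurd ((h x v hv).trans h2) (not_le.2 hcΨ)

theorem GammaConverges.of_inequalities {X : Type*} [TopologicalSpace X]
    [FirstCountableTopology X] {Φ : ℕ → X → ℝ≥0∞} {Ψ : X → ℝ≥0∞} (h : LiminfInequality Φ Ψ)
    (h' : LimsupInequality Φ Ψ) : GammaConverges Φ Ψ := by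
  intro x
  obtain ⟨v, hv, hv'⟩ := h' x
  have h1 := h.le_gammaLiminf x
  have h2 := gammaLiminf_le_gammaLimsup Φ x
  have h3 := (gammaLimsup_le_of_tendsto hv).trans hv'
  exact ⟨(h2.trans h3).antisymm h1, h3.antisymm (h1.trans h2)⟩

/-! ### Measurability and energy estimates -/

/-- Measurability in `x` is only Lebesgue, so `u` and `G` are replaced by Borel representatives and
the composite is null measurable. -/
theorem IsNormalIntegrand.aemeasurable_comp {N d : ℕ} {Ω : Set (RVec N)} (hΩ : IsOpen Ω)
    {f : RVec N → RVec d → RMat d N → ℝ} (hf : IsNormalIntegrand Ω f) {u : RVec N → RVec d}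
    {G : RVec N → RMat d N} (hu : AEStronglyMeasurable u (volume.restrict Ω))
    (hG : AEStronglyMeasurable G (volume.restrict Ω)) :
    AEMeasurable (fun x => f x (u x) (G x)) (volume.restrict Ω) := by
  have hmk : ∀ {E : Type} [MeasurableSpace E] {g : RVec N → E}, Measurable g →
      Measurable (fun x : NullMeasurableSpace (RVec N) volume => g x) := fun hg s hs =>
    (hg hs).nullMeasurableSet
  have hid : Measurable (fun x : NullMeasurableSpace (RVec N) volume => x) := measurable_id
  have hcomp := hf.1.comp (hid.prodMk
    ((hmk hu.stronglyMeasurable_mk.measurable).prodMk (hmk hG.stronglyMeasurable_mk.measurable)))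
  have hnull : NullMeasurable
      (fun x => Ω.indicator (fun x => f x (hu.mk u x) (hG.mk G x)) x) volume := fun s hs => hcomp hs
  refine hnull.aemeasurable.restrict.congr ?_
  filter_upwards [ae_restrict_mem hΩ.measurableSet, hu.ae_eq_mk, hG.ae_eq_mk] with x h1 h2 h3
  rw [indicator_of_mem h1, ← h2, ← h3]

section Energy

variable {X E : Type*} [MeasurableSpace X] {μ : Measure X} [NormedAddCommGroup E]

/-- Chebyshev's inequality for the energy density. -/
theorem measure_lt_le_of_lintegral_rpow_le {h p : X → ℝ} (hh : AEMeasurable h μ)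
    {t ε : ℝ} {C : ℝ≥0∞}
    (hdom : ∀ᵐ x ∂μ, t < h x → 1 ≤ ε * (1 / p x * h x ^ p x)) (hε : 0 ≤ ε)
    (hC : ∫⁻ x, ENNReal.ofReal (1 / p x * h x ^ p x) ∂μ ≤ C) :
    μ {x | t < h x} ≤ ENNReal.ofReal ε * C := by
  have hnull : NullMeasurableSet {x | t < h x} μ := nullMeasurableSet_lt aemeasurable_const hh
  rw [← lintegral_indicator_one₀ hnull]
  calc ∫⁻ x, {x | t < h x}.indicator 1 x ∂μ
      ≤ ∫⁻ x, ENNReal.ofReal ε * ENNReal.ofReal (1 / p x * h x ^ p x) ∂μ := by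
        refine lintegral_mono_ae ?_
        filter_upwards [hdom] with x hx
        by_cases hxt : t < h x
        · rw [indicator_of_mem (show x ∈ {x | t < h x} from hxt), Pi.one_apply,
            ← ENNReal.ofReal_mul hε, ENNReal.one_le_ofReal]
          exact hx hxt
        · rw [indicator_of_notMem (show x ∉ {x | t < h x} from hxt)]
          exact zero_le
    _ = ENNReal.ofReal ε * ∫⁻ x, ENNReal.ofReal (1 / p x * h x ^ p x) ∂μ :=
        lintegral_const_mul' _ _ ENNReal.ofReal_ne_top
    _ ≤ ENNReal.ofReal ε * C := by gcongr

theorem lintegral_enorm_sq_le_of_lintegral_rpow_le {h p : X → ℝ} {G : X → E} {α γ : ℝ}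
    (hα : 0 < α) (hγ : 0 < γ) (hcoer : ∀ᵐ x ∂μ, α * ‖G x‖ ^ γ ≤ h x) {t : ℝ} (hp : ∀ᵐ x ∂μ, 0 < p x)
    (hdom : ∀ᵐ x ∂μ, t < h x → h x ^ (2 / γ) ≤ 1 / p x * h x ^ p x) {C : ℝ≥0∞}
    (ht : 0 ≤ t)
    (hC : ∫⁻ x, ENNReal.ofReal (1 / p x * h x ^ p x) ∂μ ≤ C) :
    ∫⁻ x, ‖G x‖ₑ ^ (2 : ℝ) ∂μ ≤
      ENNReal.ofReal ((α ^ (2 / γ))⁻¹) * (ENNReal.ofReal (t ^ (2 / γ)) * μ univ + C) := by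
  have hr : 0 < 2 / γ := by positivity
  have hpt : ∀ᵐ x ∂μ, ‖G x‖ₑ ^ (2 : ℝ) ≤ ENNReal.ofReal ((α ^ (2 / γ))⁻¹) *
      (ENNReal.ofReal (t ^ (2 / γ)) + ENNReal.ofReal (1 / p x * h x ^ p x)) := by
    filter_upwards [hcoer, hp, hdom] with x h1 h2 h3
    have h0 : 0 ≤ h x := le_trans (by positivity) h1
    have hnn : 0 ≤ 1 / p x * h x ^ p x := by positivity
    rw [← ofReal_norm, ENNReal.ofReal_rpow_of_nonneg (norm_nonneg _) (by norm_num),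
      ← ENNReal.ofReal_add (by positivity) hnn, ← ENNReal.ofReal_mul (by positivity)]
    refine ENNReal.ofReal_le_ofReal ?_
    have h4 : ‖G x‖ ^ (2 : ℝ) = (‖G x‖ ^ γ) ^ (2 / γ) := by
      rw [← Real.rpow_mul (norm_nonneg _)]
      congr 1
      field_simp
    have h5 : (α * ‖G x‖ ^ γ) ^ (2 / γ) ≤ h x ^ (2 / γ) :=
      Real.rpow_le_rpow (by positivity) h1 hr.le
    rw [Real.mul_rpow hα.le (by positivity), ← h4] at h5
    -- Below the threshold `t` the power is bounded by a constant; above it, by the energy density.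
    have h6 : h x ^ (2 / γ) ≤ t ^ (2 / γ) + 1 / p x * h x ^ p x := by
      rcases lt_or_ge t (h x) with hlt | hge
      · have : 0 ≤ t ^ (2 / γ) := by positivity
        linarith [h3 hlt]
      · linarith [Real.rpow_le_rpow h0 hge hr.le]
    rw [← div_eq_inv_mul, le_div_iff₀ (by positivity)]
    linarith
  refine (lintegral_mono_ae hpt).trans ?_
  rw [lintegral_const_mul' _ _ ENNReal.ofReal_ne_top, lintegral_add_left measurable_const,
    lintegral_const]
  gcongr

end Energy

/-! ### Closure of the weak gradient and of the constraint -/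

/-- Weak gradients are stable under uniform convergence of the functions, when the gradients are
square integrable and the limit gradient lies in the closed convex hulls of the tails. -/
theorem HasWeakGradient.of_forall_mem_closedConvexHull_tail {N d : ℕ} {Ω : Set (RVec N)}
    (hΩb : Bornology.IsBounded Ω) {v : ℕ → RVec N → RVec d} {u : RVec N → RVec d}
    {G : ℕ → RVec N → RMat d N} (hv : ∀ n, HasWeakGradient Ω (v n) (G n))
    (hu : MemLp u ∞ (volume.restrict Ω)) {e : ℕ → ℝ} (he : Tendsto e atTop (𝓝 0))
    (hvu : ∀ n, ∀ᵐ x ∂(volume.restrict Ω), ‖v n x - u x‖ ≤ e n)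
    {W : ℕ → Lp (RMat d N) 2 (volume.restrict Ω)}
    (hW : ∀ n, W n =ᵐ[volume.restrict Ω] G n) {w : Lp (RMat d N) 2 (volume.restrict Ω)}
    (hw : ∀ k, w ∈ closedConvexHull ℝ (W '' Ici k)) : HasWeakGradient Ω u w := by
  have hfin : IsFiniteMeasure (volume.restrict Ω) :=
    ⟨by rw [Measure.restrict_apply_univ]; exact hΩb.measure_lt_top⟩
  have hui : Integrable u (volume.restrict Ω) := hu.integrable (by simp)
  have hwi : Integrable w (volume.restrict Ω) := (Lp.memLp w).integrable (by norm_num)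
  refine ⟨IntegrableOn.locallyIntegrableOn hui, IntegrableOn.locallyIntegrableOn hwi,
    fun φ hφ hc hs j i => ?_⟩
  have hφL : MemLp (fun x => φ x • (EuclideanSpace.single (j, i) (1 : ℝ) : RMat d N)) 2
      (volume.restrict Ω) :=
    Continuous.memLp_of_hasCompactSupport (hφ.continuous.smul continuous_const) hc.smul_right
  -- The right-hand side of the integration by parts formula, up to sign, as a continuous functional
  -- on `L²`. Its values along `W` converge because the left-hand sides do.
  set ℓ : Lp (RMat d N) 2 (volume.restrict Ω) →L[ℝ] ℝ := innerSL ℝ (hφL.toLp _)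
  have hℓ : ∀ g : Lp (RMat d N) 2 (volume.restrict Ω), ℓ g = ∫ x in Ω, g x (j, i) * φ x := by
    intro g
    simp only [ℓ, innerSL_apply_apply, L2.inner_def]
    refine integral_congr_ae ?_
    filter_upwards [hφL.coeFn_toLp] with x hx
    rw [hx, real_inner_smul_left, EuclideanSpace.inner_single_left]
    simp [mul_comm]
  have hψc : Continuous fun x => fderiv ℝ φ x (EuclideanSpace.single i 1) :=
    (hφ.continuous_fderiv (by simp)).clm_apply continuous_const
  have hψs : HasCompactSupport fun x => fderiv ℝ φ x (EuclideanSpace.single i 1) :=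
    hc.fderiv_apply ℝ _
  obtain ⟨B, hB⟩ := hψc.bounded_above_of_compact_support hψs
  obtain ⟨M, hM⟩ := he.bddAbove_range
  have hM' : ∀ n, e n ≤ M := fun n => hM ⟨n, rfl⟩
  have hlim : Tendsto (fun n => ∫ x in Ω, v n x j * fderiv ℝ φ x (EuclideanSpace.single i 1))
      atTop (𝓝 (∫ x in Ω, u x j * fderiv ℝ φ x (EuclideanSpace.single i 1))) := by
    refine tendsto_integral_of_dominated_convergence (fun x => (‖u x‖ + M) * B) ?_ ?_ ?_ ?_
    · intro n
      have h1 := (hv n).1.aestronglyMeasurable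
      exact ((EuclideanSpace.proj j : RVec d →L[ℝ] ℝ).continuous.comp_aestronglyMeasurable h1).mul
        hψc.aestronglyMeasurable
    · exact (hui.norm.add (integrable_const M)).mul_const B
    · intro n
      filter_upwards [hvu n] with x hx
      rw [norm_mul]
      have h1 : ‖v n x j‖ ≤ ‖u x‖ + M := by
        have h2 := PiLp.norm_apply_le (v n x) j
        have h3 := norm_le_norm_add_norm_sub' (v n x) (u x)
        have h4 := hM' n
        linarith
      exact mul_le_mul h1 (hB x) (norm_nonneg _) ((norm_nonneg _).trans h1)
    · filter_upwards [ae_all_iff.2 hvu] with x hx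
      have h1 : Tendsto (fun n => v n x) atTop (𝓝 (u x)) := by
        rw [tendsto_iff_norm_sub_tendsto_zero]
        exact squeeze_zero (fun n => norm_nonneg _) hx he
      exact (((EuclideanSpace.proj j : RVec d →L[ℝ] ℝ).continuous.tendsto _).comp h1).mul_const _
  have hlim' : Tendsto (fun n => ℓ (W n)) atTop
      (𝓝 (-∫ x in Ω, u x j * fderiv ℝ φ x (EuclideanSpace.single i 1))) := by
    refine hlim.neg.congr fun n => ?_
    rw [hℓ, (hv n).2.2 φ hφ hc hs j i, neg_neg]
    refine integral_congr_ae ?_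
    filter_upwards [hW n] with x hx
    rw [hx]
  rw [← hℓ, apply_eq_of_forall_mem_closedConvexHull_tail hw ℓ hlim', neg_neg]

/-- The closure property behind the lower bound: constraints that hold asymptotically along a
uniformly convergent sequence with gradients bounded in `L²` hold in the limit. -/
theorem constraintFunctional_eq_zero_of_tendsto {N d : ℕ} {Ω : Set (RVec N)} (hΩ : IsOpen Ω)
    (hΩb : Bornology.IsBounded Ω) {f : RVec N → RVec d → RMat d N → ℝ}
    (hf : IsNormalIntegrand Ω f)
    (hH1 : ∀ᵐ x ∂(volume.restrict Ω), ∀ u : RVec d, QuasiconvexOn ℝ univ (f x u))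
    {α γ : ℝ} (hα : 0 < α) (hγ : 0 < γ) (hH2 : ∀ᵐ x ∂(volume.restrict Ω),
      ∀ (u : RVec d) (ξ : RMat d N), α * ‖ξ‖ ^ γ ≤ f x u ξ)
    {v : ℕ → RVec N → RVec d} {u : RVec N → RVec d}
    {G : ℕ → RVec N → RMat d N} (hv : ∀ n, HasWeakGradient Ω (v n) (G n))
    (hu : MemLp u ∞ (volume.restrict Ω)) {e : ℕ → ℝ} (he : Tendsto e atTop (𝓝 0))
    (hvu : ∀ n, ∀ᵐ x ∂(volume.restrict Ω), ‖v n x - u x‖ ≤ e n)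
    {R : ℝ≥0∞} (hR : R ≠ ∞) (hG : ∀ n, eLpNorm (G n) 2 (volume.restrict Ω) ≤ R)
    {t : ℕ → ℝ} (ht : Tendsto t atTop (𝓝 1))
    (hle : ∀ᵐ x ∂(volume.restrict Ω), ∀ᶠ n in atTop, f x (v n x) (G n x) ≤ t n) :
    constraintFunctional Ω f u = 0 := by
  have hGm : ∀ n, MemLp (G n) 2 (volume.restrict Ω) := fun n =>
    ⟨(hv n).2.1.aestronglyMeasurable, (hG n).trans_lt hR.lt_top⟩
  set W : ℕ → Lp (RMat d N) 2 (volume.restrict Ω) := fun n => (hGm n).toLp (G n)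
  have hW : ∀ n, W n =ᵐ[volume.restrict Ω] G n := fun n => (hGm n).coeFn_toLp
  obtain ⟨w, hw⟩ := exists_forall_mem_closedConvexHull_tail W R.toReal (fun n => by
    rw [Lp.norm_toLp]
    exact ENNReal.toReal_mono hR (hG n))
  have hwg := HasWeakGradient.of_forall_mem_closedConvexHull_tail hΩb hv hu he hvu hW hw
  have hfw : ∀ᵐ x ∂(volume.restrict Ω), f x (u x) (w x) ≤ 1 := by
    filter_upwards [ae_mem_closedConvexHull_tail hw, ae_all_iff.2 hW, hle, hH1, hH2, hf.2,
      ae_all_iff.2 hvu] with x h1 h2 h3 h4 h5 h6 h7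
    have hux : Tendsto (fun n => v n x) atTop (𝓝 (u x)) := by
      rw [tendsto_iff_norm_sub_tendsto_zero]
      exact squeeze_zero (fun n => norm_nonneg _) h7 he
    simp only [h2] at h1
    exact le_of_forall_mem_closedConvexHull_tail h6 (h4 _) hα hγ h5 hux ht h3 h1
  -- Coercivity upgrades `w` from `L²` to `L^∞`.
  have hwb : ∀ᵐ x ∂(volume.restrict Ω), ‖w x‖ ≤ (1 / α) ^ γ⁻¹ := by
    filter_upwards [hfw, hH2] with x h1 h2
    have h3 : ‖w x‖ ^ γ ≤ 1 / α := by
      rw [le_div_iff₀ hα]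
      linarith [h2 (u x) (w x)]
    exact (Real.le_rpow_inv_iff_of_pos (norm_nonneg _) (by positivity) hγ).2 h3
  have hwm : MemLp w ∞ (volume.restrict Ω) :=
    memLp_top_of_bound (Lp.aestronglyMeasurable w) _ hwb
  unfold constraintFunctional
  rw [if_pos]
  refine ⟨⟨hu, w, hwg, hwm⟩, ?_⟩
  rw [eLpNorm_exponent_top]
  refine eLpNormEssSup_le_of_ae_enorm_bound ?_
  filter_upwards [hfw, hH2, hwg.weakGrad.ae_eq hΩ hwg] with x h1 h2 h3
  rw [h3, ← ofReal_norm, Real.norm_eq_abs, abs_of_nonneg, ENNReal.ofReal_le_one]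
  · exact h1
  · exact le_trans (by positivity) (h2 (u x) (w x))

/-! ### Essential bounds on the exponents and the lower bound -/

theorem eventually_ae_le_of_tendsto_expInf {N : ℕ} {Ω : Set (RVec N)} {p : ℕ → RVec N → ℝ}
    (hp : Tendsto (fun n => expInf Ω (p n)) atTop (𝓝 ∞)) (Q : ℝ) :
    ∀ᶠ n in atTop, ∀ᵐ x ∂(volume.restrict Ω), Q ≤ p n x := by
  filter_upwards [hp.eventually_const_lt (ENNReal.ofReal_lt_top (r := Q))] with n hn
  filter_upwards [ae_essInf_le (μ := volume.restrict Ω) (f := fun x => ENNReal.ofReal (p n x))]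
    with x hx
  by_contra! hlt
  exact absurd (hn.trans_le hx) (not_lt.2 (ENNReal.ofReal_le_ofReal hlt.le))

theorem exists_ae_le_of_expSup_le {N : ℕ} {Ω : Set (RVec N)} {p : RVec N → ℝ} {β : ℝ}
    (hp : expSup Ω p ≤ ENNReal.ofReal β * expInf Ω p) :
    ∃ P : ℝ, ∀ᵐ x ∂(volume.restrict Ω), p x ≤ P := by
  have h1 := ENNReal.ae_le_essSup (μ := volume.restrict Ω) (fun x => ENNReal.ofReal (p x))
  have h2 := ae_essInf_le (μ := volume.restrict Ω) (f := fun x => ENNReal.ofReal (p x))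
  by_cases htop : expInf Ω p = ∞
  -- An infinite essential infimum of a real-valued exponent forces `Ω` to be null, so any bound
  -- serves.
  · refine ⟨0, ?_⟩
    filter_upwards [h2] with x hx
    exact absurd (htop.symm.trans_le hx) (not_le.2 ENNReal.ofReal_lt_top)
  · have hne : expSup Ω p ≠ ∞ :=
      (hp.trans_lt (ENNReal.mul_lt_top ENNReal.ofReal_lt_top (lt_top_iff_ne_top.2 htop))).ne
    refine ⟨(expSup Ω p).toReal, ?_⟩
    filter_upwards [h1] with x hx
    exact (ENNReal.ofReal_le_iff_le_toReal hne).1 hx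

theorem constraintFunctional_le_liminf {N d : ℕ} {Ω : Set (RVec N)} (hΩ : IsOpen Ω)
    (hΩb : Bornology.IsBounded Ω) {p : ℕ → RVec N → ℝ}
    (hp_lim : Tendsto (fun n => expInf Ω (p n)) atTop (𝓝 ∞))
    {f : RVec N → RVec d → RMat d N → ℝ} (hf : IsNormalIntegrand Ω f)
    (hH1 : ∀ᵐ x ∂(volume.restrict Ω), ∀ u : RVec d, QuasiconvexOn ℝ univ (f x u))
    (hH2 : ∃ α γ : ℝ, 0 < α ∧ 0 < γ ∧ ∀ᵐ x ∂(volume.restrict Ω),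
      ∀ (u : RVec d) (ξ : RMat d N), α * ‖ξ‖ ^ γ ≤ f x u ξ)
    {v : ℕ → RVec N → RVec d} {u : RVec N → RVec d} (hu : MemLp u ∞ (volume.restrict Ω))
    {e : ℕ → ℝ} (he : Tendsto e atTop (𝓝 0))
    (hvu : ∀ n, ∀ᵐ x ∂(volume.restrict Ω), ‖v n x - u x‖ ≤ e n) :
    constraintFunctional Ω f u ≤ liminf (fun n => powerFunctional Ω f (p n) (v n)) atTop := by
  obtain ⟨α, γ, hα, hγ, hcoer⟩ := hH2
  have hfin : IsFiniteMeasure (volume.restrict Ω) :=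
    ⟨by rw [Measure.restrict_apply_univ]; exact hΩb.measure_lt_top⟩
  by_cases htop : liminf (fun n => powerFunctional Ω f (p n) (v n)) atTop = ∞
  · rw [htop]
    exact le_top
  obtain ⟨C, hC, hCtop⟩ := exists_between (lt_top_iff_ne_top.2 htop)
  have hfreq := frequently_lt_of_liminf_lt (by isBoundedDefault) hC
  set t : ℕ → ℝ := fun k => 1 + 1 / ((k : ℝ) + 1)
  have ht1 : ∀ k, 1 < t k := fun k => by
    have : 0 < 1 / ((k : ℝ) + 1) := by positivity
    simp only [t]
    linarith
  have ht2 : ∀ k, t k ≤ 2 := fun k => by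
    have : 1 / ((k : ℝ) + 1) ≤ 1 := by
      rw [div_le_one (by positivity)]
      linarith [(Nat.cast_nonneg k : (0 : ℝ) ≤ k)]
    simp only [t]
    linarith
  have ht : Tendsto t atTop (𝓝 1) := by
    simpa [t] using (tendsto_one_div_add_atTop_nhds_zero_nat (𝕜 := ℝ)).const_add 1
  have hr : 0 < 2 / γ := by positivity
  -- The factors `(1 / 2) ^ k` make the measures of `{t k < h k}` summable, as Borel-Cantelli
  -- requires.
  choose Q hQ using fun k : ℕ =>
    exists_rpow_le_mul_rpow (2 / γ) (ht1 k) (ε := (1 / 2 : ℝ) ^ k) (by positivity)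
  obtain ⟨ψ, hψ, hψ'⟩ := extraction_forall_of_frequently fun k =>
    hfreq.and_eventually (eventually_ae_le_of_tendsto_expInf hp_lim (max 1 (Q k)))
  have hmem : ∀ k, MemW1Var Ω (p (ψ k)) (v (ψ k)) := fun k => by
    by_contra hcon
    have := (hψ' k).1
    rw [powerFunctional, if_neg hcon] at this
    exact not_top_lt this
  have hgrad : ∀ k, HasWeakGradient Ω (v (ψ k)) (weakGrad Ω (v (ψ k))) := fun k => by
    obtain ⟨-, G, hG, -⟩ := hmem k
    exact hG.weakGrad
  set h : ℕ → RVec N → ℝ := fun k x => f x (v (ψ k) x) (weakGrad Ω (v (ψ k)) x)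
  have hint : ∀ k, ∫⁻ x in Ω, ENNReal.ofReal (1 / p (ψ k) x * h k x ^ p (ψ k) x) ≤ C :=
    fun k => by
      have := (hψ' k).1
      rw [powerFunctional, if_pos (hmem k)] at this
      exact this.le
  have hhm : ∀ k, AEMeasurable (h k) (volume.restrict Ω) := fun k =>
    hf.aemeasurable_comp hΩ (hgrad k).1.aestronglyMeasurable (hgrad k).2.1.aestronglyMeasurable
  have hdom : ∀ k, ∀ᵐ x ∂(volume.restrict Ω), t k < h k x →
      h k x ^ (2 / γ) ≤ (1 / 2 : ℝ) ^ k * (1 / p (ψ k) x * h k x ^ p (ψ k) x) := fun k => by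
    filter_upwards [(hψ' k).2] with x hx hlt
    exact hQ k _ ((le_max_right _ _).trans hx) _ hlt
  have hpos : ∀ k, ∀ᵐ x ∂(volume.restrict Ω), 0 < p (ψ k) x := fun k => by
    filter_upwards [(hψ' k).2] with x hx
    exact zero_lt_one.trans_le ((le_max_left _ _).trans hx)
  have hcoer' : ∀ k, ∀ᵐ x ∂(volume.restrict Ω), α * ‖weakGrad Ω (v (ψ k)) x‖ ^ γ ≤ h k x :=
    fun k => by
      filter_upwards [hcoer] with x hx using hx _ _
  have hmeas : ∀ k, volume.restrict Ω {x | t k < h k x} ≤ ENNReal.ofReal ((1 / 2 : ℝ) ^ k) * C :=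
    fun k => by
      refine measure_lt_le_of_lintegral_rpow_le (hhm k) ?_ (by positivity) (hint k)
      filter_upwards [hdom k] with x hx hlt
      exact (Real.one_le_rpow ((ht1 k).trans hlt).le hr.le).trans (hx hlt)
  have hsum : ∑' k, volume.restrict Ω {x | t k < h k x} ≠ ∞ := by
    refine ne_top_of_le_ne_top ?_ (ENNReal.tsum_le_tsum hmeas)
    rw [ENNReal.tsum_mul_right]
    refine ENNReal.mul_ne_top ?_ hCtop.ne
    rw [← ENNReal.ofReal_tsum_of_nonneg (fun k => by positivity) summable_geometric_two]
    exact ENNReal.ofReal_ne_top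
  have hle : ∀ᵐ x ∂(volume.restrict Ω), ∀ᶠ k in atTop, h k x ≤ t k := by
    filter_upwards [ae_eventually_notMem hsum] with x hx
    filter_upwards [hx] with k hk
    exact not_lt.1 hk
  set K : ℝ≥0∞ := ENNReal.ofReal ((α ^ (2 / γ))⁻¹) *
    (ENNReal.ofReal (2 ^ (2 / γ)) * volume.restrict Ω univ + C)
  have hK : K ≠ ∞ := ENNReal.mul_ne_top ENNReal.ofReal_ne_top
    (ENNReal.add_ne_top.2 ⟨ENNReal.mul_ne_top ENNReal.ofReal_ne_top (measure_ne_top _ _), hCtop.ne⟩)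
  -- The fixed threshold `2 ≥ t k` keeps the bound independent of `k`.
  have hL2 : ∀ k, eLpNorm (weakGrad Ω (v (ψ k))) 2 (volume.restrict Ω) ≤ K ^ (1 / 2 : ℝ) :=
    fun k => by
      rw [eLpNorm_eq_lintegral_rpow_enorm_toReal (by norm_num) (by norm_num), ENNReal.toReal_ofNat]
      refine ENNReal.rpow_le_rpow ?_ (by norm_num)
      refine lintegral_enorm_sq_le_of_lintegral_rpow_le hα hγ (hcoer' k) (t := 2) (hpos k) ?_
        (by norm_num) (hint k)
      filter_upwards [hdom k, hpos k, hcoer' k] with x h1 h2 h3 hlt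
      have h0 : 0 ≤ h k x := le_trans (by positivity) h3
      refine (h1 ((ht2 k).trans_lt hlt)).trans (mul_le_of_le_one_left (by positivity) ?_)
      exact pow_le_one₀ (by norm_num) (by norm_num)
  rw [constraintFunctional_eq_zero_of_tendsto hΩ hΩb hf hH1 hα hγ hcoer hgrad hu
    (he.comp hψ.tendsto_atTop) (fun k => hvu (ψ k))
    (ENNReal.rpow_ne_top_of_nonneg (by norm_num) hK) hL2 ht hle]
  exact zero_le

/-! ### The upper bound -/

theorem memLpVar_of_memLp_top {N : ℕ} {V : Type*} [NormedAddCommGroup V] {Ω : Set (RVec N)}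
    (hΩb : Bornology.IsBounded Ω) {p : RVec N → ℝ} {P : ℝ}
    (hp0 : ∀ᵐ x ∂(volume.restrict Ω), 0 ≤ p x) (hpP : ∀ᵐ x ∂(volume.restrict Ω), p x ≤ P)
    {v : RVec N → V} (hv : MemLp v ∞ (volume.restrict Ω)) : MemLpVar Ω p v := by
  refine ⟨hv.1, ?_⟩
  have hM : eLpNormEssSup v (volume.restrict Ω) < ∞ := by
    rw [← eLpNorm_exponent_top]
    exact hv.2
  -- With `M ≥ 1`, its powers increase with the exponent.
  set M := max 1 (eLpNormEssSup v (volume.restrict Ω))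
  have hMtop : M ≠ ∞ := (max_lt ENNReal.one_lt_top hM).ne
  have hle : ∀ᵐ x ∂(volume.restrict Ω), ‖v x‖ₑ ^ p x ≤ M ^ max P 0 := by
    filter_upwards [hp0, hpP, ae_le_eLpNormEssSup (f := v)] with x h1 h2 h3
    exact (ENNReal.rpow_le_rpow (h3.trans (le_max_right _ _)) h1).trans
      (ENNReal.rpow_le_rpow_of_exponent_le (le_max_left _ _) (h2.trans (le_max_left _ _)))
  refine (lintegral_mono_ae hle).trans_lt ?_
  rw [lintegral_const, Measure.restrict_apply_univ]
  exact ENNReal.mul_lt_top (ENNReal.rpow_lt_top_of_nonneg (le_max_right _ _) hMtop)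
    hΩb.measure_lt_top

theorem limsup_powerFunctional_le {N d : ℕ} {Ω : Set (RVec N)} (hΩ : IsOpen Ω)
    (hΩb : Bornology.IsBounded Ω) {p : ℕ → RVec N → ℝ} (hp_one : ∀ n, ∀ x ∈ Ω, 1 < p n x)
    (hp_lim : Tendsto (fun n => expInf Ω (p n)) atTop (𝓝 ∞)) {β : ℝ}
    (hp_ratio : ∀ n, expSup Ω (p n) ≤ ENNReal.ofReal β * expInf Ω (p n))
    {f : RVec N → RVec d → RMat d N → ℝ}
    (hf0 : ∀ᵐ x ∂(volume.restrict Ω), ∀ (u : RVec d) (ξ : RMat d N), 0 ≤ f x u ξ)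
    (u : RVec N → RVec d) :
    limsup (fun n => powerFunctional Ω f (p n) u) atTop ≤ constraintFunctional Ω f u := by
  by_cases hcon : MemW1Infty Ω u ∧
      eLpNorm (fun x => f x (u x) (weakGrad Ω u x)) ∞ (volume.restrict Ω) ≤ 1
  swap
  · rw [constraintFunctional, if_neg hcon]
    exact le_top
  rw [constraintFunctional, if_pos hcon]
  obtain ⟨⟨hu, G, hG, hGb⟩, hf1⟩ := hcon
  have hp1 : ∀ n, ∀ᵐ x ∂(volume.restrict Ω), 1 < p n x := fun n => by
    filter_upwards [ae_restrict_mem hΩ.measurableSet] with x hx using hp_one n x hx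
  have hmem : ∀ n, MemW1Var Ω (p n) u := fun n => by
    obtain ⟨P, hP⟩ := exists_ae_le_of_expSup_le (hp_ratio n)
    have h0 : ∀ᵐ x ∂(volume.restrict Ω), 0 ≤ p n x := (hp1 n).mono fun x hx => by linarith
    exact ⟨memLpVar_of_memLp_top hΩb h0 hP hu, G, hG, memLpVar_of_memLp_top hΩb h0 hP hGb⟩
  have hf1' : ∀ᵐ x ∂(volume.restrict Ω), f x (u x) (weakGrad Ω u x) ≤ 1 := by
    rw [eLpNorm_exponent_top] at hf1
    filter_upwards [ae_le_eLpNormEssSup (f := fun x => f x (u x) (weakGrad Ω u x))] with x hx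
    have h1 := hx.trans hf1
    rw [← ofReal_norm, ENNReal.ofReal_le_one] at h1
    exact (le_abs_self _).trans h1
  have hbound : ∀ k : ℕ, limsup (fun n => powerFunctional Ω f (p n) u) atTop ≤
      ENNReal.ofReal (1 / ((k : ℝ) + 1)) * volume Ω := by
    intro k
    refine limsup_le_of_le (by isBoundedDefault) ?_
    filter_upwards [eventually_ae_le_of_tendsto_expInf hp_lim ((k : ℝ) + 1)] with n hn
    rw [powerFunctional, if_pos (hmem n), ← Measure.restrict_apply_univ, ← lintegral_const]
    refine lintegral_mono_ae ?_
    filter_upwards [hn, hf0, hf1', hp1 n] with x h1 h2 h3 h4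
    refine ENNReal.ofReal_le_ofReal ?_
    have h5 := Real.rpow_le_one (h2 (u x) (weakGrad Ω u x)) h3 (z := p n x) (by linarith)
    calc 1 / p n x * f x (u x) (weakGrad Ω u x) ^ p n x ≤ 1 / p n x * 1 := by gcongr
      _ ≤ 1 / ((k : ℝ) + 1) := by
        rw [mul_one]
        exact one_div_le_one_div_of_le (by positivity) h1
  have hz : Tendsto (fun k : ℕ => ENNReal.ofReal (1 / ((k : ℝ) + 1)) * volume Ω) atTop (𝓝 0) := by
    have h1 := ENNReal.tendsto_ofReal (tendsto_one_div_add_atTop_nhds_zero_nat (𝕜 := ℝ))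
    rw [ENNReal.ofReal_zero] at h1
    simpa using ENNReal.Tendsto.mul_const h1 (Or.inr hΩb.measure_lt_top.ne)
  exact ge_of_tendsto' hz hbound

/-! ### The two choices of the space and the theorem -/

theorem ae_norm_sub_le_norm_sub {X E : Type*} [MeasurableSpace X] {μ : Measure X}
    [NormedAddCommGroup E] (u v : Lp E ∞ μ) : ∀ᵐ x ∂μ, ‖v x - u x‖ ≤ ‖v - u‖ := by
  filter_upwards [Lp.coeFn_sub v u, ae_le_eLpNormEssSup (f := (v - u : Lp E ∞ μ)) (μ := μ)]
    with x h1 h2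
  rw [← Pi.sub_apply, ← h1, Lp.norm_def, ← toReal_enorm, eLpNorm_exponent_top]
  refine ENNReal.toReal_mono ?_ h2
  rw [← eLpNorm_exponent_top]
  exact Lp.eLpNorm_ne_top _

theorem extendZero_apply {N d : ℕ} {Ω : Set (RVec N)} (u : Ω → RVec d) (x : Ω) :
    extendZero u x = u x :=
  Subtype.val_injective.extend_apply _ _ _

theorem memLp_top_extendZero {N d : ℕ} {Ω : Set (RVec N)} (hΩ : IsOpen Ω) (u : Ω →ᵇ RVec d) :
    MemLp (extendZero u) ∞ (volume.restrict Ω) := by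
  refine memLp_top_of_bound ?_ ‖u‖ ?_
  · refine ContinuousOn.aestronglyMeasurable ?_ hΩ.measurableSet
    rw [continuousOn_iff_continuous_domRestrict]
    refine u.continuous.congr fun x => ?_
    rw [domRestrict_apply, extendZero_apply]
  · filter_upwards [ae_restrict_mem hΩ.measurableSet] with x hx
    exact (congrArg norm (extendZero_apply u ⟨x, hx⟩)).trans_le (u.norm_coe_le_norm _)

theorem mainTheorem4 {N d : ℕ} (hN : 1 ≤ N) (hd : 1 ≤ d)
    (Ω : Set (RVec N)) (hΩ : IsOpen Ω) (hΩb : Bornology.IsBounded Ω)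
    (p : ℕ → RVec N → ℝ)
    (hp_meas : ∀ n, AEMeasurable (p n) (volume.restrict Ω))
    (hp_one : ∀ n, ∀ x ∈ Ω, 1 < p n x)
    (hp_lim : Tendsto (fun n => expInf Ω (p n)) atTop (𝓝 ∞))
    (hp_ratio : ∃ β : ℝ, 1 < β ∧ ∀ n, expSup Ω (p n) ≤ ENNReal.ofReal β * expInf Ω (p n))
    (f : RVec N → RVec d → RMat d N → ℝ) (hf : IsNormalIntegrand Ω f)
    (hH1 : ∀ᵐ x ∂(volume.restrict Ω), ∀ u : RVec d, QuasiconvexOn ℝ univ (f x u))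
    (hH2 : ∃ α γ : ℝ, 0 < α ∧ 0 < γ ∧ ∀ᵐ x ∂(volume.restrict Ω),
      ∀ (u : RVec d) (ξ : RMat d N), α * ‖ξ‖ ^ γ ≤ f x u ξ) :
    (LiminfInequality
        (fun n (u : Lp (RVec d) ∞ (volume.restrict Ω)) => powerFunctional Ω f (p n) u)
        (fun u => constraintFunctional Ω f u) ∧
      LimsupInequality
        (fun n (u : Lp (RVec d) ∞ (volume.restrict Ω)) => powerFunctional Ω f (p n) u)
        (fun u => constraintFunctional Ω f u) ∧
      GammaConverges
        (fun n (u : Lp (RVec d) ∞ (volume.restrict Ω)) => powerFunctional Ω f (p n) u)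
        (fun u => constraintFunctional Ω f u)) ∧
    (LiminfInequality
        (fun n (u : Ω →ᵇ RVec d) => powerFunctional Ω f (p n) (extendZero u))
        (fun u => constraintFunctional Ω f (extendZero u)) ∧
      LimsupInequality
        (fun n (u : Ω →ᵇ RVec d) => powerFunctional Ω f (p n) (extendZero u))
        (fun u => constraintFunctional Ω f (extendZero u)) ∧
      GammaConverges
        (fun n (u : Ω →ᵇ RVec d) => powerFunctional Ω f (p n) (extendZero u))
        (fun u => constraintFunctional Ω f (extendZero u))) := by
  obtain ⟨β, -, hβ⟩ := hp_ratio
  have hf0 : ∀ᵐ x ∂(volume.restrict Ω), ∀ (u : RVec d) (ξ : RMat d N), 0 ≤ f x u ξ := by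
    obtain ⟨α, γ, hα, hγ, h⟩ := hH2
    filter_upwards [h] with x hx u ξ
    exact le_trans (by positivity) (hx u ξ)
  have hinf : LiminfInequality
      (fun n (u : Lp (RVec d) ∞ (volume.restrict Ω)) => powerFunctional Ω f (p n) u)
      (fun u => constraintFunctional Ω f u) := fun u v hv =>
    constraintFunctional_le_liminf hΩ hΩb hp_lim hf hH1 hH2 (Lp.memLp u)
      (tendsto_iff_norm_sub_tendsto_zero.1 hv) fun n => ae_norm_sub_le_norm_sub u (v n)
  have hsup : LimsupInequality
      (fun n (u : Lp (RVec d) ∞ (volume.restrict Ω)) => powerFunctional Ω f (p n) u)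
      (fun u => constraintFunctional Ω f u) := fun u =>
    ⟨fun _ => u, tendsto_const_nhds, limsup_powerFunctional_le hΩ hΩb hp_one hp_lim hβ hf0 u⟩
  have hinf' : LiminfInequality
      (fun n (u : Ω →ᵇ RVec d) => powerFunctional Ω f (p n) (extendZero u))
      (fun u => constraintFunctional Ω f (extendZero u)) := fun u v hv => by
    refine constraintFunctional_le_liminf hΩ hΩb hp_lim hf hH1 hH2 (memLp_top_extendZero hΩ u)
      (tendsto_iff_norm_sub_tendsto_zero.1 hv) fun n => ?_
    filter_upwards [ae_restrict_mem hΩ.measurableSet] with x hx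
    have h1 := extendZero_apply (v n) ⟨x, hx⟩
    have h2 := extendZero_apply u ⟨x, hx⟩
    dsimp only at h1 h2
    rw [h1, h2]
    exact (v n - u).norm_coe_le_norm ⟨x, hx⟩
  have hsup' : LimsupInequality
      (fun n (u : Ω →ᵇ RVec d) => powerFunctional Ω f (p n) (extendZero u))
      (fun u => constraintFunctional Ω f (extendZero u)) := fun u =>
    ⟨fun _ => u, tendsto_const_nhds, limsup_powerFunctional_le hΩ hΩb hp_one hp_lim hβ hf0 _⟩
  exact ⟨⟨hinf, hsup, .of_inequalities hinf hsup⟩, hinf', hsup', .of_inequalities hinf' hsup'⟩
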